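/- A receiver streams an infinite file. It starts playback, at unit rate, with $D\ge 0$ packets buffered. Packets from a free server arrive according to a Poisson process $N$ of rate $R_0$, and packets from a costly server according to an independent Poisson process $N^c$ of rate $R_1-R_0$, where $R_1>R_0>1$. At each time $t$ the receiver chooses $u_t\in\{0,1\}$: only the free server is used if $u_t=0$, both servers if $u_t=1$. The buffer size is $$Q_t = D + N_t + \int_0^t u_\tau\,dN^c_\tau - t .$$ Let $\Pi$ be the set of (deterministic) control policies, i.e. mappings $\pi$ from histories to $\{0,1\}$ for which the rule $u_t=\pi(h_t)$, with $h_t=\{Q_{s^-}:0\le s\le t\}\cup\{u_s:0\le s<t\}$ (and $Q_{0^-}=Q_0=D$), almost surely determines unique paths $(Q_t)$ and $(u_t)$, and these form measurable processes. Let $\tau_0=\inf\{t\ge 0: Q_t=0\}$ (with $\inf\emptyset=\infty$), let $p^\pi(D)=\Pr\{\tau_0<\infty\}$ be the interruption probability under $\pi$, and for $\epsilon>0$ call $\pi$ $(D,\epsilon)$-feasible if $p^\pi(D)\le\epsilon$. The cost of a policy is $$J^\pi(D,\epsilon)=\mathbb E\Big[\int_0^{\tau_0}u_t\,dt\Big]\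 \text{ if } \pi \text{ is } (D,\epsilon)\text{-feasible},\qquad J^\pi(D,\epsilon)=\infty\ \text{ otherwise.}$$ For $R>1$ let $I(R)$ be the largest root of $\gamma(r)=r+R(e^{-r}-1)$. **Theorem.** Let $R_1>R_0>1$, $D\ge 0$ and $\epsilon>0$. (a) If $D\ge \frac{1}{I(R_0)}\log\frac1\epsilon$, then the policy $\pi_0\equiv 0$ that always uses only the free server belongs to $\Pi$, is $(D,\epsilon)$-feasible and has cost $0$; in particular $\min_{\pi\in\Pi}J^\pi(D,\epsilon)=0$. (b) If $D< \frac{1}{I(R_1)}\log\frac1\epsilon$, then no policy in $\Pi$ is $(D,\epsilon)$-feasible, and $\min_{\pi\in\Pi}J^\pi(D,\epsilon)=\infty$. -/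

import Mathlib

open MeasureTheory ProbabilityTheory Set Filter Topology
open scoped NNReal ENNReal

noncomputable section

namespace Streaming

/-! ### Poisson processes and the two-server system -/

/-- `N` is a (homogeneous) Poisson process of rate `R` on `(Ω, μ)`: a counting process started at
zero, with nondecreasing right-continuous paths and independent increments, whose increment over
`(s, t]` has the Poisson distribution of mean `R (t - s)`. -/
structure IsPoissonProcess {Ω : Type*} [MeasurableSpace Ω] (μ : Measure Ω) (R : ℝ)
    (N : ℝ≥0 → Ω → ℕ) : Prop where
  measurable : ∀ t, Measurable (N t)
  zero : ∀ ω, N 0 ω = 0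
  mono : ∀ ω, Monotone fun t => N t ω
  rightCont : ∀ ω t, ContinuousWithinAt (fun s => N s ω) (Ici t) t
  indepIncrements : HasIndepIncrements N μ
  law : ∀ s t : ℝ≥0, s ≤ t →
    μ.map (fun ω => N t ω - N s ω) = poissonMeasure (R * (t - s)).toNNReal

/-- The packet arrivals of a free server, of rate `R₀`, and of an independent costly server of
rate `R₁ - R₀`, so that the total rate when both servers are used is `R₁`. -/
structure TwoServerSystem {Ω : Type*} [MeasurableSpace Ω] (μ : Measure Ω) (R₀ R₁ : ℝ) where
  free : ℝ≥0 → Ω → ℕ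
  costly : ℝ≥0 → Ω → ℕ
  isPoisson_free : IsPoissonProcess μ R₀ free
  isPoisson_costly : IsPoissonProcess μ (R₁ - R₀) costly
  indep : IndepFun (fun ω t => free t ω) (fun ω t => costly t ω) μ

/-! ### Association policies -/

/-- A history up to some time `t`: the buffer sizes observed at the times `s ≤ t` and the actions
taken at the times `s < t`. -/
abbrev History : Type :=
  Σ t : ℝ≥0, (Iic t → ℝ) × (Iio t → Fin 2)

/-- A deterministic association policy: a mapping from the set of all histories to the actions,
where `0` means that only the free server is used and `1` that both servers are used. -/
abbrev Policy : Type := History → Fin 2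

/-- The policy that always uses the free server only. -/
def freeServerOnly : Policy := fun _ => 0

/-- The history `h_t` of the buffer-size path `q` and the action path `u`. The action at time `t`
selects the servers whose packets are accepted at time `t`, so the buffer size it may look at is the
one just before a packet arriving at that instant, i.e. the left limit `q (s-)`
(which is `q 0` at `s = 0`). -/
def history (q : ℝ≥0 → ℝ) (u : ℝ≥0 → Fin 2) (t : ℝ≥0) : History :=
  ⟨t, fun s => Function.leftLim q s, fun s => u s⟩

/-- The pathwise integral `∫₀ᵗ u dn` of an action path against a counting path: the sum over the
jump times `s ∈ (0, t]` of `u s` times the jump of `n` at `s`. -/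
def jumpIntegral (u : ℝ≥0 → Fin 2) (n : ℝ≥0 → ℕ) (t : ℝ≥0) : ℕ :=
  ∑ᶠ s ∈ Ioc 0 t, (u s : ℕ) * (n s - Function.leftLim n s)

/-- The paths `q` (buffer size) and `u` (actions) are generated by the policy `π` from the initial
buffer size `D` and the arrival paths `n` (free server) and `c` (costly server):
`q t = D + n t + ∫₀ᵗ u dc - t` and `u t = π (h_t)` for all `t`. -/
def IsClosedLoop (π : Policy) (D : ℝ) (n c : ℝ≥0 → ℕ) (q : ℝ≥0 → ℝ) (u : ℝ≥0 → Fin 2) : Prop :=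
  ∀ t : ℝ≥0, q t = D + n t + jumpIntegral u c t - t ∧ u t = π (history q u t)

variable {Ω : Type*} [MeasurableSpace Ω] {μ : Measure Ω} {R₀ R₁ : ℝ}

/-- `(Q, u)` is the buffer-size and action process governed by `π`: both processes are measurable,
and almost surely their paths are the unique paths generated by `π` from the arrivals. -/
def Governs (S : TwoServerSystem μ R₀ R₁) (D : ℝ) (π : Policy)
    (Q : ℝ≥0 → Ω → ℝ) (u : ℝ≥0 → Ω → Fin 2) : Prop :=
  (∀ t, Measurable (Q t)) ∧ Measurable (Function.uncurry u) ∧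
    ∀ᵐ ω ∂μ, ∀ (q : ℝ≥0 → ℝ) (v : ℝ≥0 → Fin 2),
      IsClosedLoop π D (fun t => S.free t ω) (fun t => S.costly t ω) q v ↔
        (q = fun t => Q t ω) ∧ (v = fun t => u t ω)

/-- The set `Π` of control policies: the policies that can be run, i.e. that determine a
buffer-size process and an action process. -/
def Policies (S : TwoServerSystem μ R₀ R₁) (D : ℝ) : Set Policy :=
  {π | ∃ Q u, Governs S D π Q u}

/-- The buffer-size process under a control policy (unique up to almost sure equality). -/
def buffer (S : TwoServerSystem μ R₀ R₁) (D : ℝ) (π : Policies S D) : ℝ≥0 → Ω → ℝ :=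
  π.2.choose

/-- The action process under a control policy (unique up to almost sure equality). -/
def action (S : TwoServerSystem μ R₀ R₁) (D : ℝ) (π : Policies S D) : ℝ≥0 → Ω → Fin 2 :=
  π.2.choose_spec.choose

/-! ### Interruption probability, feasibility and cost -/

/-- The interruption time `τ₀ = inf {t : Q_t = 0}`, equal to `∞` if the buffer never empties. -/
def interruptionTime (S : TwoServerSystem μ R₀ R₁) (D : ℝ) (π : Policies S D) (ω : Ω) : ℝ≥0∞ :=
  sInf {x | ∃ t : ℝ≥0, buffer S D π t ω = 0 ∧ x = t}

/-- The interruption probability `p^π(D) = P(τ₀ < ∞)`. -/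
def interruptionProb (S : TwoServerSystem μ R₀ R₁) (D : ℝ) (π : Policies S D) : ℝ :=
  μ.real {ω | interruptionTime S D π ω < ∞}

/-- `π` is `(D, ε)`-feasible: `p^π(D) ≤ ε`. -/
def IsFeasible (S : TwoServerSystem μ R₀ R₁) (D ε : ℝ) (π : Policies S D) : Prop :=
  interruptionProb S D π ≤ ε

open Classical in
/-- The cost `J^π(D, ε) = E[∫₀^{τ₀} u_t dt]`, with the convention that the cost of an infeasible
policy is infinite. -/
def cost (S : TwoServerSystem μ R₀ R₁) (D ε : ℝ) (π : Policies S D) : ℝ≥0∞ :=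
  if IsFeasible S D ε π then
    ∫⁻ ω, ∫⁻ t in {t : ℝ | 0 ≤ t ∧ ENNReal.ofReal t < interruptionTime S D π ω},
      ((action S D π t.toNNReal ω : ℕ) : ℝ≥0∞) ∂volume ∂μ
  else ∞

/-- `I(R)`: the largest root of `γ(r) = r + R (e^{-r} - 1)`. -/
def interruptionExponent (R : ℝ) : ℝ :=
  sSup {r : ℝ | r + R * (Real.exp (-r) - 1) = 0}

/-- The set of roots does have a largest element, so the supremum is attained. -/
theorem isGreatest_interruptionExponent {R : ℝ} (hR : 0 ≤ R) :
    IsGreatest {r : ℝ | r + R * (Real.exp (-r) - 1) = 0} (interruptionExponent R) := by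
  have hne : {r : ℝ | r + R * (Real.exp (-r) - 1) = 0}.Nonempty := ⟨0, by simp⟩
  have hb : BddAbove {r : ℝ | r + R * (Real.exp (-r) - 1) = 0} := by
    refine ⟨R, fun r hr => ?_⟩
    have hr' : r + R * (Real.exp (-r) - 1) = 0 := hr
    nlinarith [mul_nonneg hR (Real.exp_pos (-r)).le]
  have hc : IsClosed {r : ℝ | r + R * (Real.exp (-r) - 1) = 0} :=
    isClosed_eq (by fun_prop) continuous_const
  exact ⟨hc.csSup_mem hne hb, fun r hr => le_csSup hb hr⟩

end Streaming

end

/-! If packets arrive as a Poisson process `M` of rate `R`, then `exp (-r (D + M t - t))` is a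
martingale exactly when `γ(r) = 0`. Optional stopping at the emptying time with `r = I(R)` gives
emptying probability `e^{-I(R) D}`. For (a), the free server alone therefore empties with
probability at most `e^{-I(R₀) D} ≤ ε`. For (b), the buffer under any policy lies below the one fed
by both servers. Since it only jumps upward, it must hit `0` whenever that larger buffer becomes
nonpositive, so every policy is interrupted with probability at least `e^{-I(R₁) D} > ε`.

Stopping is done in discrete time, on the grid of mesh `h`, where the buffer is a random walk.
`measure_exists_nonpos_le` bounds the ruin probability above uniformly in `h`, and dyadic refinement
with right-continuity carries this to continuous time. `le_measure_exists_nonpos` bounds it below up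
to a factor `e^{I(R) h}`, the price of the overshoot, and `h → 0` removes the factor. The pathwise
comparison rests on `jumpIntegral_le` and `exists_eq_zero_of_nonpos`. -/

namespace Streaming

/-! ### The Lundberg bounds for a random walk -/

section Lundberg

variable {Ω : Type*} {X : ℕ → Ω → ℝ}

/-- The event that the walk `X` stays positive up to step `n`. -/
def alive (X : ℕ → Ω → ℝ) (n : ℕ) : Set Ω := {ω | ∀ k ≤ n, 0 < X k ω}

theorem alive_succ_subset (n : ℕ) : alive X (n + 1) ⊆ alive X n :=
  fun _ h k hk => h k (by omega)

theorem nonpos_of_mem_alive_diff {n : ℕ} {ω : Ω} (h : ω ∈ alive X n \ alive X (n + 1)) :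
    X (n + 1) ω ≤ 0 := by
  by_contra! hpos
  refine h.2 fun k hk => ?_
  rcases Nat.lt_or_eq_of_le hk with hk | rfl
  · exact h.1 k (by omega)
  · exact hpos

variable [MeasurableSpace Ω] {μ : Measure Ω}

theorem measurableSet_alive (hX : ∀ n, Measurable (X n)) (n : ℕ) : MeasurableSet (alive X n) := by
  have : alive X n = ⋂ k, ⋂ _ : k ≤ n, {ω | 0 < X k ω} := by ext; simp [alive]
  rw [this]
  exact .iInter fun k => .iInter fun _ => measurableSet_lt measurable_const (hX k)

theorem lintegral_alive_eq_add (hX : ∀ n, Measurable (X n)) (n : ℕ) (f : Ω → ℝ≥0∞) :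
    ∫⁻ ω in alive X n, f ω ∂μ =
      ∫⁻ ω in alive X n \ alive X (n + 1), f ω ∂μ + ∫⁻ ω in alive X (n + 1), f ω ∂μ := by
  rw [← lintegral_inter_add_sdiff f (alive X n) (measurableSet_alive hX (n + 1)),
    inter_eq_self_of_subset_right (alive_succ_subset n), add_comm]

theorem measure_compl_alive_succ (hX : ∀ n, Measurable (X n)) (n : ℕ) :
    μ (alive X (n + 1))ᶜ = μ (alive X n)ᶜ + μ (alive X n \ alive X (n + 1)) := by
  rw [← measure_union]
  · congr 1
    ext ω
    have := fun h => alive_succ_subset (X := X) n (a := ω) h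
    simp only [mem_compl_iff, mem_union, Set.mem_sdiff]
    tauto
  · exact disjoint_left.2 fun ω h h' => h h'.1
  · exact (measurableSet_alive hX _).diff (measurableSet_alive hX _)

/-- One martingale step on the survival event: survival and `X n` are functions of the past, and the
independent increment contributes a factor `1`. -/
theorem lintegral_alive_exp_succ (hX : ∀ n, Measurable (X n)) {n : ℕ}
    (hind : IndepFun (fun ω (k : Fin (n + 1)) => X k ω) (fun ω => X (n + 1) ω - X n ω) μ)
    {r : ℝ} (hr : ∫⁻ ω, .ofReal (Real.exp (-r * (X (n + 1) ω - X n ω))) ∂μ = 1) :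
    ∫⁻ ω in alive X n, .ofReal (Real.exp (-r * X (n + 1) ω)) ∂μ =
      ∫⁻ ω in alive X n, .ofReal (Real.exp (-r * X n ω)) ∂μ := by
  let B : Set (Fin (n + 1) → ℝ) := {p | ∀ k, 0 < p k}
  have hB : MeasurableSet B := by
    have : B = ⋂ k, {p | 0 < p k} := by ext; simp [B]
    rw [this]
    exact .iInter fun k => measurableSet_lt measurable_const (measurable_pi_apply k)
  let φ : (Fin (n + 1) → ℝ) → ℝ≥0∞ :=
    B.indicator fun p => .ofReal (Real.exp (-r * p (Fin.last n)))
  have hφ : Measurable φ := Measurable.indicator (by fun_prop) hB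
  let ψ : ℝ → ℝ≥0∞ := fun y => .ofReal (Real.exp (-r * y))
  have hψ : Measurable ψ := by fun_prop
  have hmem : ∀ ω, (fun k : Fin (n + 1) => X k ω) ∈ B ↔ ω ∈ alive X n := fun ω =>
    ⟨fun h k hk => h ⟨k, by omega⟩, fun h k => h k (by omega)⟩
  have key := lintegral_mul_eq_lintegral_mul_lintegral_of_indepFun
    (f := fun ω => φ fun k : Fin (n + 1) => X k ω) (g := fun ω => ψ (X (n + 1) ω - X n ω))
    (hφ.comp (measurable_pi_lambda _ fun k => hX k)) (hψ.comp ((hX _).sub (hX _)))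
    (hind.comp hφ hψ)
  rw [show ∫⁻ ω, ψ (X (n + 1) ω - X n ω) ∂μ = 1 from hr, mul_one] at key
  rw [← lintegral_indicator (measurableSet_alive hX n),
    ← lintegral_indicator (measurableSet_alive hX n)]
  have h1 : ∀ ω, φ (fun k : Fin (n + 1) => X k ω) =
      (alive X n).indicator (fun ω => .ofReal (Real.exp (-r * X n ω))) ω := by
    intro ω
    by_cases h : ω ∈ alive X n
    · simp [φ, h, (hmem ω).2 h]
    · simp [φ, h, mt (hmem ω).1 h]
  rw [← lintegral_congr h1, ← key]
  refine lintegral_congr fun ω => ?_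
  rw [Pi.mul_apply, h1]
  by_cases h : ω ∈ alive X n
  · simp only [h, indicator_of_mem, ψ]
    rw [← ENNReal.ofReal_mul (Real.exp_pos _).le, ← Real.exp_add]
    ring_nf
  · simp [h]

/-- Used with an exponent for which `c < 1`, so that this expectation decays geometrically. -/
theorem lintegral_exp_eq_pow_mul [IsProbabilityMeasure μ] (hX : ∀ n, Measurable (X n))
    {D : ℝ} (h0 : ∀ ω, X 0 ω = D)
    (hind : ∀ n, IndepFun (fun ω (k : Fin (n + 1)) => X k ω) (fun ω => X (n + 1) ω - X n ω) μ)
    {s : ℝ} {c : ℝ≥0∞}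
    (hs : ∀ n, ∫⁻ ω, .ofReal (Real.exp (-s * (X (n + 1) ω - X n ω))) ∂μ = c) (n : ℕ) :
    ∫⁻ ω, .ofReal (Real.exp (-s * X n ω)) ∂μ = .ofReal (Real.exp (-s * D)) * c ^ n := by
  induction n with
  | zero => simp [h0]
  | succ n ih =>
    have hψ : Measurable fun y : ℝ => ENNReal.ofReal (Real.exp (-s * y)) := by fun_prop
    have key := lintegral_mul_eq_lintegral_mul_lintegral_of_indepFun
      (hψ.comp (hX n)) (hψ.comp ((hX (n + 1)).sub (hX n)))
      ((hind n).comp (hψ.comp (measurable_pi_apply (Fin.last n))) hψ)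
    simp only [Pi.mul_apply, Function.comp_apply, Pi.sub_apply] at key
    rw [hs n, ih] at key
    rw [pow_succ, ← mul_assoc, ← key]
    refine lintegral_congr fun ω => ?_
    rw [← ENNReal.ofReal_mul (Real.exp_pos _).le, ← Real.exp_add]
    ring_nf

variable [IsProbabilityMeasure μ]

/-- Optional stopping at the first nonpositive value of the walk, upper bound. -/
theorem measure_compl_alive_add_le (hX : ∀ n, Measurable (X n))
    {D : ℝ} (hD : 0 ≤ D) (h0 : ∀ ω, X 0 ω = D)
    (hind : ∀ n, IndepFun (fun ω (k : Fin (n + 1)) => X k ω) (fun ω => X (n + 1) ω - X n ω) μ)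
    {r : ℝ} (hr0 : 0 ≤ r)
    (hr : ∀ n, ∫⁻ ω, .ofReal (Real.exp (-r * (X (n + 1) ω - X n ω))) ∂μ = 1) (n : ℕ) :
    μ (alive X n)ᶜ + ∫⁻ ω in alive X n, .ofReal (Real.exp (-r * X n ω)) ∂μ ≤
      .ofReal (Real.exp (-r * D)) := by
  induction n with
  | zero =>
    rcases hD.eq_or_lt with rfl | hD
    · have : alive X 0 = ∅ := by ext; simp [alive, h0]
      simp [this]
    · have : alive X 0 = univ := by ext; simp [alive, h0, hD]
      simp [this, h0]
  | succ n ih =>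
    refine le_trans ?_ ih
    rw [← lintegral_alive_exp_succ hX (hind n) (hr n), lintegral_alive_eq_add hX n,
      measure_compl_alive_succ hX, ← add_assoc]
    gcongr
    rw [← setLIntegral_one]
    refine setLIntegral_mono' ((measurableSet_alive hX _).diff (measurableSet_alive hX _))
      fun ω hω => ?_
    -- At the exit step the walk is nonpositive, so the exponential weight is at least `1`.
    rw [ENNReal.one_le_ofReal, Real.one_le_exp_iff]
    nlinarith [nonpos_of_mem_alive_diff hω]

/-- Optional stopping at the first nonpositive value of the walk, lower bound. -/
theorem le_measure_compl_alive_add (hX : ∀ n, Measurable (X n))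
    {D h : ℝ} (hD : 0 ≤ D) (hh : 0 ≤ h) (h0 : ∀ ω, X 0 ω = D)
    (hstep : ∀ n ω, X n ω - h ≤ X (n + 1) ω)
    (hind : ∀ n, IndepFun (fun ω (k : Fin (n + 1)) => X k ω) (fun ω => X (n + 1) ω - X n ω) μ)
    {r : ℝ} (hr0 : 0 ≤ r)
    (hr : ∀ n, ∫⁻ ω, .ofReal (Real.exp (-r * (X (n + 1) ω - X n ω))) ∂μ = 1) (n : ℕ) :
    .ofReal (Real.exp (-r * D)) ≤ .ofReal (Real.exp (r * h)) * μ (alive X n)ᶜ +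
      ∫⁻ ω in alive X n, .ofReal (Real.exp (-r * X n ω)) ∂μ := by
  induction n with
  | zero =>
    rcases hD.eq_or_lt with rfl | hD
    · have : alive X 0 = ∅ := by ext; simp [alive, h0]
      simp only [this, compl_empty, measure_univ, mul_one]
      refine le_add_right (ENNReal.ofReal_le_ofReal (Real.exp_le_exp.2 ?_))
      nlinarith
    · have : alive X 0 = univ := by ext; simp [alive, h0, hD]
      simp [this, h0]
  | succ n ih =>
    refine ih.trans ?_
    rw [← lintegral_alive_exp_succ hX (hind n) (hr n), lintegral_alive_eq_add hX n,
      measure_compl_alive_succ hX, mul_add, ← add_assoc]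
    gcongr
    rw [← setLIntegral_const]
    refine setLIntegral_mono' ((measurableSet_alive hX _).diff (measurableSet_alive hX _))
      fun ω hω => ENNReal.ofReal_le_ofReal (Real.exp_le_exp.2 ?_)
    -- The walk was positive one step earlier, so it exits above `-h` and the weight is at most
    -- `e^{rh}`.
    nlinarith [hstep n ω, hω.1 n le_rfl]

theorem measure_exists_nonpos_le (hX : ∀ n, Measurable (X n))
    {D : ℝ} (hD : 0 ≤ D) (h0 : ∀ ω, X 0 ω = D)
    (hind : ∀ n, IndepFun (fun ω (k : Fin (n + 1)) => X k ω) (fun ω => X (n + 1) ω - X n ω) μ)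
    {r : ℝ} (hr0 : 0 ≤ r)
    (hr : ∀ n, ∫⁻ ω, .ofReal (Real.exp (-r * (X (n + 1) ω - X n ω))) ∂μ = 1) :
    μ {ω | ∃ n, X n ω ≤ 0} ≤ .ofReal (Real.exp (-r * D)) := by
  have hU : {ω | ∃ n, X n ω ≤ 0} = ⋃ n, (alive X n)ᶜ := by
    ext ω
    simp only [mem_ofPred_eq, mem_iUnion, mem_compl_iff, alive, not_forall, not_lt]
    exact ⟨fun ⟨n, h⟩ => ⟨n, n, le_rfl, h⟩, fun ⟨_, k, _, h⟩ => ⟨k, h⟩⟩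
  have hmono : Monotone fun n => (alive X n)ᶜ :=
    monotone_nat_of_le_succ fun n => compl_subset_compl.2 (alive_succ_subset n)
  rw [hU, hmono.measure_iUnion]
  exact iSup_le fun n => le_self_add.trans (measure_compl_alive_add_le hX hD h0 hind hr0 hr n)

/-- The surviving mass in the lower bound vanishes: a surviving walk is positive, so `e^{-r X n} ≤
e^{-s X n}`, whose full expectation is `e^{-sD} c^n → 0`. -/
theorem le_measure_exists_nonpos (hX : ∀ n, Measurable (X n))
    {D h : ℝ} (hD : 0 ≤ D) (hh : 0 ≤ h) (h0 : ∀ ω, X 0 ω = D)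
    (hstep : ∀ n ω, X n ω - h ≤ X (n + 1) ω)
    (hind : ∀ n, IndepFun (fun ω (k : Fin (n + 1)) => X k ω) (fun ω => X (n + 1) ω - X n ω) μ)
    {r s : ℝ} {c : ℝ≥0∞} (hs0 : 0 ≤ s) (hsr : s ≤ r) (hc : c < 1)
    (hr : ∀ n, ∫⁻ ω, .ofReal (Real.exp (-r * (X (n + 1) ω - X n ω))) ∂μ = 1)
    (hs : ∀ n, ∫⁻ ω, .ofReal (Real.exp (-s * (X (n + 1) ω - X n ω))) ∂μ = c) :
    .ofReal (Real.exp (-r * D)) ≤ .ofReal (Real.exp (r * h)) * μ {ω | ∃ n, X n ω ≤ 0} := by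
  have hlim : Tendsto (fun n : ℕ => .ofReal (Real.exp (r * h)) * μ {ω | ∃ n, X n ω ≤ 0} +
      .ofReal (Real.exp (-s * D)) * c ^ n) atTop
      (𝓝 (.ofReal (Real.exp (r * h)) * μ {ω | ∃ n, X n ω ≤ 0} +
        .ofReal (Real.exp (-s * D)) * 0)) :=
    (ENNReal.Tendsto.const_mul (ENNReal.tendsto_pow_atTop_nhds_zero_of_lt_one hc)
      (.inr ENNReal.ofReal_ne_top)).const_add _
  rw [mul_zero, add_zero] at hlim
  refine ge_of_tendsto' hlim fun n =>
    (le_measure_compl_alive_add hX hD hh h0 hstep hind (hs0.trans hsr) hr n).trans ?_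
  gcongr
  · intro ω hω
    simp only [alive, mem_compl_iff, mem_ofPred_eq, not_forall, not_lt] at hω
    obtain ⟨k, _, hk⟩ := hω
    exact ⟨k, hk⟩
  · rw [← lintegral_exp_eq_pow_mul hX h0 hind hs n]
    refine (setLIntegral_mono' (measurableSet_alive hX n) fun ω hω =>
      ENNReal.ofReal_le_ofReal (Real.exp_le_exp.2 ?_)).trans (setLIntegral_le_lintegral _ _)
    nlinarith [hω n le_rfl]

end Lundberg

/-! ### Counting paths -/

section CountingPath

variable {n : ℝ≥0 → ℕ}

/-- Jumps telescope: all those before the largest time `m` are already counted in the left limit at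
`m`. -/
theorem sum_jump_le (hn : Monotone n) (F : Finset ℝ≥0) :
    ∀ t, (∀ s ∈ F, s ≤ t) → ∑ s ∈ F, (n s - Function.leftLim n s) ≤ n t := by
  induction F using Finset.induction_on_max with
  | empty => simp
  | insert m F hF ih =>
    intro t ht
    rw [Finset.sum_insert fun h => (hF m h).false]
    have hmt : n m ≤ n t := hn (ht m (Finset.mem_insert_self m F))
    have hlim : Function.leftLim n m ≤ n m := hn.leftLim_le le_rfl
    rcases F.eq_empty_or_nonempty with rfl | hne
    · simp only [Finset.sum_empty]
      omega
    · have h1 := ih (F.max' hne) fun s hs => F.le_max' s hs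
      have h2 : n (F.max' hne) ≤ Function.leftLim n m := hn.le_leftLim (hF _ (F.max'_mem hne))
      omega

/-- Each nonzero jump is at least `1`. Finiteness ensures that the `finsum` in `jumpIntegral` is a
true sum and not the default `0`. -/
theorem finite_jumps (hn : Monotone n) (t : ℝ≥0) :
    {s | s ∈ Ioc 0 t ∧ n s - Function.leftLim n s ≠ 0}.Finite := by
  by_contra hinf
  obtain ⟨F, hF, hcard⟩ := Set.Infinite.exists_subset_card_eq hinf (n t + 1)
  have h1 := sum_jump_le hn F t fun s hs => (hF hs).1.2
  have h2 : F.card • 1 ≤ ∑ s ∈ F, (n s - Function.leftLim n s) :=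
    Finset.card_nsmul_le_sum _ _ _ fun s hs => Nat.one_le_iff_ne_zero.2 (hF hs).2
  simp only [hcard, smul_eq_mul, mul_one] at h2
  omega

/-- A common horizon `T` makes integrals up to different times comparable. -/
theorem jumpIntegral_eq_sum (hn : Monotone n) (u : ℝ≥0 → Fin 2) {t T : ℝ≥0} (h : t ≤ T) :
    jumpIntegral u n t = ∑ s ∈ (finite_jumps hn T).toFinset with s ≤ t,
      (u s : ℕ) * (n s - Function.leftLim n s) := by
  refine finsum_mem_eq_sum_of_inter_support_eq _ ?_
  ext s
  simp only [mem_inter_iff, mem_Ioc, Function.mem_support, ne_eq, mul_eq_zero, not_or,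
    Finset.coe_filter, Finite.mem_toFinset, mem_ofPred_eq]
  exact ⟨fun ⟨⟨h1, h2⟩, h3⟩ => ⟨⟨⟨⟨h1, h2.trans h⟩, h3.2⟩, h2⟩, h3⟩,
    fun ⟨⟨⟨h1, _⟩, h2⟩, h3⟩ => ⟨⟨h1.1, h2⟩, h3⟩⟩

theorem jumpIntegral_mono (hn : Monotone n) (u : ℝ≥0 → Fin 2) : Monotone (jumpIntegral u n) := by
  intro s t hst
  rw [jumpIntegral_eq_sum hn u hst, jumpIntegral_eq_sum hn u le_rfl]
  exact Finset.sum_le_sum_of_subset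
    (Finset.monotone_filter_right _ fun _ _ (h : _ ≤ s) => h.trans hst)

theorem jumpIntegral_le (hn : Monotone n) (u : ℝ≥0 → Fin 2) (t : ℝ≥0) :
    jumpIntegral u n t ≤ n t := by
  rw [jumpIntegral_eq_sum hn u le_rfl]
  refine le_trans (Finset.sum_le_sum fun s _ => ?_)
    (sum_jump_le hn _ t fun s hs => (Finset.mem_filter.1 hs).2)
  exact (Nat.mul_le_mul_right _ (Nat.lt_succ_iff.1 (u s).2)).trans (one_mul _).le

theorem jumpIntegral_zero_left (n : ℝ≥0 → ℕ) (t : ℝ≥0) : jumpIntegral (fun _ => 0) n t = 0 := by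
  simp [jumpIntegral]

/-- A path with upward jumps that decreases at unit rate between them cannot skip `0`. -/
theorem exists_eq_zero_of_nonpos {a : ℝ≥0 → ℕ} (ha : Monotone a) {D : ℝ} (hD : 0 ≤ D)
    (h : ∃ t : ℝ≥0, D + a t - t ≤ 0) : ∃ t : ℝ≥0, D + a t - t = 0 := by
  set B : Set ℝ≥0 := {t | D + a t - t ≤ 0}
  set T := sInf B
  have hcast : ∀ {s t : ℝ≥0}, s ≤ t → (a s : ℝ) ≤ a t := fun hst => Nat.cast_le.2 (ha hst)
  have hT : D + a T ≤ T := by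
    refine le_of_forall_pos_le_add fun ε hε => ?_
    obtain ⟨s, hs, hsT⟩ := exists_lt_of_csInf_lt h (lt_add_of_pos_right T (Real.toNNReal_pos.2 hε))
    have hs' : D + a s - s ≤ 0 := hs
    have h1 : (s : ℝ) < T + ε := by
      have : (s : ℝ) < (T + ε.toNNReal : ℝ≥0) := NNReal.coe_lt_coe.2 hsT
      simpa [hε.le] using this
    linarith [hcast (csInf_le' hs : T ≤ s)]
  refine ⟨T, le_antisymm (by linarith) (sub_nonneg.2 ?_)⟩
  by_contra! hlt
  have h0 : 0 ≤ D + a T := by positivity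
  -- If the value at `T` were negative, then `a s ≤ a T` would already make the path nonpositive at
  -- this earlier time, contradicting the infimum.
  set s : ℝ≥0 := ⟨D + a T, h0⟩
  have hs : s < T := NNReal.coe_lt_coe.1 hlt
  have hle := hcast hs.le
  have hsB : D + a s - (D + a T) ≤ 0 := by linarith
  exact notMem_of_lt_csInf' hs hsB

/-- A right-continuous path that hits `0` is nonpositive at a point of some dyadic grid. -/
theorem exists_dyadic_nonpos {D : ℝ} (hn : ∀ t, ContinuousWithinAt n (Ici t) t)
    (h : ∃ t : ℝ≥0, D + n t - t = 0) :
    ∃ m k : ℕ, D + n (k * (2⁻¹ ^ m : ℝ≥0)) - (k * (2⁻¹ ^ m : ℝ≥0) : ℝ≥0) ≤ 0 := by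
  obtain ⟨t, ht⟩ := h
  -- Right-continuity with values in `ℕ` means constancy just after `t`; the first grid point at or
  -- after `t` then lies in that interval.
  have h1 : ∀ᶠ s in 𝓝[≥] t, n s = n t := (hn t).eventually_mem (by simp : {n t} ∈ 𝓝 (n t))
  obtain ⟨b, hb, hsub⟩ := (mem_nhdsGE_iff_exists_Ico_subset' (lt_add_one t)).1 h1
  obtain ⟨m, hm⟩ := exists_pow_lt_of_lt_one (tsub_pos_of_lt (show t < b from hb))
    (show (2⁻¹ : ℝ≥0) < 1 by rw [inv_lt_one₀] <;> norm_num)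
  have hpos : (0 : ℝ≥0) < 2⁻¹ ^ m := by positivity
  set k := ⌈t / 2⁻¹ ^ m⌉₊
  have hle : t ≤ k * 2⁻¹ ^ m := (div_le_iff₀ hpos).1 (Nat.le_ceil _)
  have hlt : k * 2⁻¹ ^ m < b := by
    have h2 : (k : ℝ≥0) < t / 2⁻¹ ^ m + 1 := Nat.ceil_lt_add_one (by positivity)
    calc (k : ℝ≥0) * 2⁻¹ ^ m < (t / 2⁻¹ ^ m + 1) * 2⁻¹ ^ m := by gcongr
      _ = t + 2⁻¹ ^ m := by field_simp
      _ < b := by rw [add_comm]; exact lt_tsub_iff_right.1 hm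
  refine ⟨m, k, ?_⟩
  rw [show n (k * 2⁻¹ ^ m) = n t from hsub ⟨hle, hlt⟩]
  have := NNReal.coe_le_coe.2 hle
  linarith

end CountingPath

/-! ### The interruption exponent -/

/-- `γ(r) = r + R (e^{-r} - 1)`. -/
noncomputable def cramerExponent (R r : ℝ) : ℝ := r + R * (Real.exp (-r) - 1)

theorem cramerExponent_interruptionExponent {R : ℝ} (hR : 0 ≤ R) :
    cramerExponent R (interruptionExponent R) = 0 :=
  (isGreatest_interruptionExponent hR).1

theorem strictConvexOn_cramerExponent {R : ℝ} (hR : 0 < R) :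
    StrictConvexOn ℝ univ (cramerExponent R) := by
  refine ⟨convex_univ, fun x _ y _ hxy a b ha hb hab => ?_⟩
  have h := strictConvexOn_exp.2 (mem_univ (-x)) (mem_univ (-y)) (by simpa using hxy) ha hb hab
  simp only [smul_eq_mul, cramerExponent] at h ⊢
  rw [show -(a * x + b * y) = a * -x + b * -y by ring]
  have := mul_lt_mul_of_pos_left h hR
  nlinarith

/-- `γ` is nonpositive at its minimiser `log R > 0`, and `γ(R) = R e^{-R} ≥ 0`, so a root lies
between. -/
theorem interruptionExponent_pos {R : ℝ} (hR : 1 < R) : 0 < interruptionExponent R := by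
  have hcont : Continuous (cramerExponent R) := by unfold cramerExponent; fun_prop
  have hlog : 0 < Real.log R := Real.log_pos hR
  have h1 : cramerExponent R (Real.log R) ≤ 0 := by
    have := Real.log_le_sub_one_of_pos (zero_lt_one.trans hR)
    rw [cramerExponent, Real.exp_neg, Real.exp_log (by linarith), mul_sub,
      mul_inv_cancel₀ (by linarith)]
    linarith
  have h2 : 0 ≤ cramerExponent R R := by
    rw [cramerExponent]
    nlinarith [Real.exp_pos (-R)]
  have hle : Real.log R ≤ R := (Real.log_le_sub_one_of_pos (by linarith)).trans (by linarith)
  obtain ⟨r, hr, hr0⟩ := intermediate_value_Icc hle hcont.continuousOn ⟨h1, h2⟩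
  exact hlog.trans_le (hr.1.trans ((isGreatest_interruptionExponent (by linarith)).2 hr0))

/-- Strict convexity between the roots `0` and `I(R)`; the midpoint serves as the exponent `s` with
`c < 1`. -/
theorem cramerExponent_half_neg {R : ℝ} (hR : 1 < R) :
    cramerExponent R (interruptionExponent R / 2) < 0 := by
  have hpos := interruptionExponent_pos hR
  have h := (strictConvexOn_cramerExponent (zero_lt_one.trans hR)).2 (mem_univ 0)
    (mem_univ (interruptionExponent R)) hpos.ne (one_half_pos (α := ℝ)) one_half_pos (by norm_num)
  rw [cramerExponent_interruptionExponent (by linarith)] at h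
  have h0 : cramerExponent R 0 = 0 := by simp [cramerExponent]
  simp only [smul_eq_mul, mul_zero, zero_add, h0] at h
  rwa [one_div_mul_eq_div] at h

/-! ### Poisson increments -/

theorem lintegral_exp_poissonMeasure (a : ℝ≥0) (s : ℝ) :
    ∫⁻ k, .ofReal (Real.exp (-s * (k : ℝ))) ∂poissonMeasure a =
      .ofReal (Real.exp (a * (Real.exp (-s) - 1))) := by
  have hsum : HasSum (fun k : ℕ => Real.exp (-a) * a ^ k / k.factorial * Real.exp (-s * k))
      (Real.exp (a * (Real.exp (-s) - 1))) := by
    convert! (NormedSpace.expSeries_div_hasSum_exp ((a : ℝ) * Real.exp (-s))).mul_left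
      (Real.exp (-a)) using 1
    · ext k
      rw [mul_pow, ← Real.exp_nat_mul]
      ring_nf
    · rw [← Real.exp_eq_exp_ℝ, ← Real.exp_add]
      ring_nf
  rw [poissonMeasure, lintegral_sum_measure, ← hsum.tsum_eq,
    ENNReal.ofReal_tsum_of_nonneg (fun k => by positivity) hsum.summable]
  refine tsum_congr fun k => ?_
  rw [lintegral_smul_measure, lintegral_dirac, smul_eq_mul, ← ENNReal.ofReal_mul (by positivity)]

variable {Ω : Type*} [MeasurableSpace Ω] {μ : Measure Ω}

/-- Independence of pairs from the independence within and between the components. -/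
theorem IndepFun.prodMk_prodMk_of_countable {α β γ δ : Type*}
    [MeasurableSpace α] [MeasurableSpace β] [MeasurableSpace γ] [MeasurableSpace δ]
    [Countable α] [Countable β] [Countable γ] [Countable δ]
    [MeasurableSingletonClass α] [MeasurableSingletonClass β]
    [MeasurableSingletonClass γ] [MeasurableSingletonClass δ] [IsProbabilityMeasure μ]
    {f : Ω → α} {g : Ω → β} {f' : Ω → γ} {g' : Ω → δ}
    (hf : Measurable f) (hg : Measurable g) (hf' : Measurable f') (hg' : Measurable g')
    (h : IndepFun f g μ) (h' : IndepFun f' g' μ)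
    (hh : IndepFun (fun ω => (f ω, g ω)) (fun ω => (f' ω, g' ω)) μ) :
    IndepFun (fun ω => (f ω, f' ω)) (fun ω => (g ω, g' ω)) μ := by
  have hff : IndepFun f f' μ := hh.comp measurable_fst measurable_fst
  have hgg : IndepFun g g' μ := hh.comp measurable_snd measurable_snd
  rw [indepFun_iff_map_prod_eq_prod_map_map (by fun_prop) (by fun_prop)]
  refine Measure.ext_of_singleton fun ⟨⟨a, c⟩, ⟨b, d⟩⟩ => ?_
  rw [← singleton_prod_singleton, Measure.prod_prod,
    Measure.map_apply (by fun_prop) (by measurability), Measure.map_apply (by fun_prop) (by simp),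
    Measure.map_apply (by fun_prop) (by simp)]
  -- The fourfold probability factors completely via `e0`, `e1`, `e2`, and regroups via `e3`, `e4`.
  have e0 := hh.measure_inter_preimage_eq_mul {(a, b)} {(c, d)} (by simp) (by simp)
  have e1 := h.measure_inter_preimage_eq_mul {a} {b} (by simp) (by simp)
  have e2 := h'.measure_inter_preimage_eq_mul {c} {d} (by simp) (by simp)
  have e3 := hff.measure_inter_preimage_eq_mul {a} {c} (by simp) (by simp)
  have e4 := hgg.measure_inter_preimage_eq_mul {b} {d} (by simp) (by simp)
  have s0 : (fun ω => ((f ω, f' ω), (g ω, g' ω))) ⁻¹' ({(a, c)} ×ˢ {(b, d)}) =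
    (fun ω => (f ω, g ω)) ⁻¹' {(a, b)} ∩ (fun ω => (f' ω, g' ω)) ⁻¹' {(c, d)} := by
      ext ω; simp; tauto
  have s1 : (fun ω => (f ω, g ω)) ⁻¹' {(a, b)} = f ⁻¹' {a} ∩ g ⁻¹' {b} := by ext; simp
  have s2 : (fun ω => (f' ω, g' ω)) ⁻¹' {(c, d)} = f' ⁻¹' {c} ∩ g' ⁻¹' {d} := by ext; simp
  have s3 : (fun ω => (f ω, f' ω)) ⁻¹' {(a, c)} = f ⁻¹' {a} ∩ f' ⁻¹' {c} := by ext; simp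
  have s4 : (fun ω => (g ω, g' ω)) ⁻¹' {(b, d)} = g ⁻¹' {b} ∩ g' ⁻¹' {d} := by ext; simp
  rw [s0, e0, s1, s2, s3, s4, e1, e2, e3, e4]
  ring

/-- Along every equidistant grid, `M` has increments that are independent of the past and have the
Laplace transform of the Poisson distribution of mean `R h`. -/
structure HasPoissonGrid (μ : Measure Ω) (R : ℝ) (M : ℝ≥0 → Ω → ℕ) : Prop where
  measurable : ∀ t, Measurable (M t)
  zero : ∀ ω, M 0 ω = 0
  mono : ∀ ω, Monotone fun t => M t ω
  indep : ∀ (h : ℝ≥0) (n : ℕ), IndepFun (fun ω (k : Fin (n + 1)) => M ((k : ℕ) * h) ω)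
    (fun ω => M ((n + 1 : ℕ) * h) ω - M (n * h) ω) μ
  laplace : ∀ (h : ℝ≥0) (n : ℕ) (s : ℝ),
    ∫⁻ ω, .ofReal (Real.exp (-s * (M ((n + 1 : ℕ) * h) ω - M (n * h) ω : ℕ))) ∂μ =
      .ofReal (Real.exp (R * h * (Real.exp (-s) - 1)))

theorem grid_le (h : ℝ≥0) (n : ℕ) : (n : ℝ≥0) * h ≤ (n + 1 : ℕ) * h := by
  gcongr
  omega

theorem IsPoissonProcess.hasPoissonGrid {R : ℝ} (hR : 0 ≤ R) {N : ℝ≥0 → Ω → ℕ}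
    (hN : IsPoissonProcess μ R N) : HasPoissonGrid μ R N where
  measurable := hN.measurable
  zero := hN.zero
  mono := hN.mono
  indep h n := by
    have hmono : Monotone fun k : ℕ => (k : ℝ≥0) * h := fun i j hij => by dsimp only; gcongr
    have hmeas : ∀ i : ℕ, Measurable fun ω => N ((i + 1 : ℕ) * h) ω - N (i * h) ω :=
      fun i => (hN.measurable _).sub (hN.measurable _)
    have hind := (hN.indepIncrements.nat hmono).indepFun_finset (Finset.range n) {n}
      (by simp) hmeas
    -- Since `N 0 = 0`, the past grid values are partial sums of the past increments.
    refine (hind.comp (φ := fun p (k : Fin (n + 1)) =>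
      ∑ i : Finset.range n, if (i : ℕ) < k then p i else 0)
      (ψ := fun p => p ⟨n, Finset.mem_singleton_self n⟩) (by fun_prop) (by fun_prop)).congr ?_ .rfl
    refine .of_forall fun ω => funext fun k => ?_
    have key : ∀ j : ℕ,
        ∑ i ∈ Finset.range j, (N ((i + 1 : ℕ) * h) ω - N (i * h) ω) = N (j * h) ω := by
      intro j
      induction j with
      | zero => simp [hN.zero]
      | succ j ih =>
        rw [Finset.sum_range_succ, ih]
        have := hN.mono ω (grid_le h j)
        dsimp only at this
        omega
    have hk := k.2
    simp only [Function.comp_apply]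
    rw [Finset.sum_coe_sort (Finset.range n)
      (fun i => if i < (k : ℕ) then N ((i + 1 : ℕ) * h) ω - N (i * h) ω else 0), ← key k,
      ← Finset.sum_filter]
    congr 1
    ext i
    simp only [Finset.mem_filter, Finset.mem_range]
    omega
  laplace h n s := by
    have hmap := hN.law _ _ (grid_le h n)
    have := lintegral_map (μ := μ) (f := fun k : ℕ => ENNReal.ofReal (Real.exp (-s * (k : ℝ))))
      (g := fun ω => N ((n + 1 : ℕ) * h) ω - N (n * h) ω) .of_discrete
      ((hN.measurable _).sub (hN.measurable _))
    rw [← this, hmap, lintegral_exp_poissonMeasure]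
    have e : R * (((n + 1 : ℕ) * h : ℝ≥0) - (n * h : ℝ≥0)) = R * h := by push_cast; ring
    rw [e, Real.coe_toNNReal _ (by positivity)]

/-- Superposition at the level of grids: Laplace transforms multiply, and independence follows by
regrouping. -/
theorem HasPoissonGrid.add [IsProbabilityMeasure μ] {R R' : ℝ} {M M' : ℝ≥0 → Ω → ℕ}
    (hM : HasPoissonGrid μ R M) (hM' : HasPoissonGrid μ R' M')
    (hind : IndepFun (fun ω t => M t ω) (fun ω t => M' t ω) μ) :
    HasPoissonGrid μ (R + R') fun t ω => M t ω + M' t ω where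
  measurable t := (hM.measurable t).add (hM'.measurable t)
  zero ω := by simp [hM.zero, hM'.zero]
  mono ω := (hM.mono ω).add (hM'.mono ω)
  indep h n := by
    have hφ : Measurable fun p : ℝ≥0 → ℕ => ((fun k : Fin (n + 1) => p ((k : ℕ) * h)),
      p ((n + 1 : ℕ) * h) - p (n * h)) := by fun_prop
    have h1 := IndepFun.prodMk_prodMk_of_countable
      (measurable_pi_lambda _ fun k : Fin (n + 1) => hM.measurable ((k : ℕ) * h))
      ((hM.measurable _).sub (hM.measurable _))
      (measurable_pi_lambda _ fun k : Fin (n + 1) => hM'.measurable ((k : ℕ) * h))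
      ((hM'.measurable _).sub (hM'.measurable _))
      (hM.indep h n) (hM'.indep h n) (hind.comp hφ hφ)
    refine (h1.comp (φ := fun p => p.1 + p.2) (ψ := fun p => p.1 + p.2)
      (by fun_prop) (by fun_prop)).congr .rfl (.of_forall fun ω => ?_)
    have e1 := hM.mono ω (grid_le h n)
    have e2 := hM'.mono ω (grid_le h n)
    simp only [Function.comp_apply, Pi.sub_apply] at e1 e2 ⊢
    omega
  laplace h n s := by
    have hφ : Measurable fun p : ℝ≥0 → ℕ => ENNReal.ofReal
      (Real.exp (-s * (p ((n + 1 : ℕ) * h) - p (n * h) : ℕ))) := by fun_prop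
    have hm : ∀ {K : ℝ≥0 → Ω → ℕ}, (∀ t, Measurable (K t)) → Measurable fun ω t => K t ω :=
      fun h => measurable_pi_lambda _ h
    have key := lintegral_mul_eq_lintegral_mul_lintegral_of_indepFun
      (hφ.comp (hm hM.measurable)) (hφ.comp (hm hM'.measurable)) (hind.comp hφ hφ)
    simp only [Pi.mul_apply, Function.comp_apply] at key
    rw [hM.laplace, hM'.laplace, ← ENNReal.ofReal_mul (Real.exp_pos _).le, ← Real.exp_add] at key
    rw [show (R + R') * h * (Real.exp (-s) - 1) =
      R * h * (Real.exp (-s) - 1) + R' * h * (Real.exp (-s) - 1) by ring, ← key]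
    refine lintegral_congr fun ω => ?_
    rw [← ENNReal.ofReal_mul (Real.exp_pos _).le, ← Real.exp_add, ← mul_add, ← Nat.cast_add]
    have e1 := hM.mono ω (grid_le h n)
    have e2 := hM'.mono ω (grid_le h n)
    dsimp only at e1 e2
    congr 5
    omega

/-! ### The buffer when the arrivals form a Poisson process -/

section Ruin

variable {Ω : Type*} [MeasurableSpace Ω] {μ : Measure Ω} {R : ℝ} {M : ℝ≥0 → Ω → ℕ}

/-- The buffer size `D + M_t - t` at the times of the grid of mesh `h`. -/
def gridWalk (D : ℝ) (M : ℝ≥0 → Ω → ℕ) (h : ℝ≥0) (n : ℕ) (ω : Ω) : ℝ :=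
  D + M (n * h) ω - (n * h : ℝ≥0)

theorem gridWalk_succ_sub (hM : HasPoissonGrid μ R M) (D : ℝ) (h : ℝ≥0) (n : ℕ) (ω : Ω) :
    gridWalk D M h (n + 1) ω - gridWalk D M h n ω =
      (M ((n + 1 : ℕ) * h) ω - M (n * h) ω : ℕ) - h := by
  rw [Nat.cast_sub (hM.mono ω (grid_le h n)), gridWalk, gridWalk]
  push_cast
  ring

theorem measurable_gridWalk (hM : HasPoissonGrid μ R M) (D : ℝ) (h : ℝ≥0) (n : ℕ) :
    Measurable (gridWalk D M h n) := by
  have := hM.measurable (n * h)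
  unfold gridWalk
  fun_prop

theorem gridWalk_zero (hM : HasPoissonGrid μ R M) (D : ℝ) (h : ℝ≥0) (ω : Ω) :
    gridWalk D M h 0 ω = D := by
  simp [gridWalk, hM.zero]

theorem indepFun_gridWalk (hM : HasPoissonGrid μ R M) (D : ℝ) (h : ℝ≥0) (n : ℕ) :
    IndepFun (fun ω (k : Fin (n + 1)) => gridWalk D M h k ω)
      (fun ω => gridWalk D M h (n + 1) ω - gridWalk D M h n ω) μ := by
  simp_rw [gridWalk_succ_sub hM]
  exact (hM.indep h n).comp
    (φ := fun (p : Fin (n + 1) → ℕ) k => D + p k - ((k : ℕ) * h : ℝ≥0)) (ψ := fun m : ℕ => (m : ℝ) - h)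
    (by fun_prop) (by fun_prop)

/-- This links `γ` to the walk: roots of `γ` give factor `1` for every mesh, and `γ(s) < 0` gives
decay. -/
theorem laplace_gridWalk (hM : HasPoissonGrid μ R M) (D : ℝ) (h : ℝ≥0) (n : ℕ) (s : ℝ) :
    ∫⁻ ω, .ofReal (Real.exp (-s * (gridWalk D M h (n + 1) ω - gridWalk D M h n ω))) ∂μ =
      .ofReal (Real.exp (h * cramerExponent R s)) := by
  rw [cramerExponent, mul_add, Real.exp_add, ENNReal.ofReal_mul (Real.exp_pos _).le,
    ← mul_assoc, mul_comm _ R, ← hM.laplace h n s, ← lintegral_const_mul']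
  · refine lintegral_congr fun ω => ?_
    rw [gridWalk_succ_sub hM, ← ENNReal.ofReal_mul (Real.exp_pos _).le, ← Real.exp_add]
    ring_nf
  · exact ENNReal.ofReal_ne_top

variable [IsProbabilityMeasure μ] {D : ℝ}

theorem measure_exists_gridWalk_nonpos_le (hR : 1 < R) (hM : HasPoissonGrid μ R M) (hD : 0 ≤ D)
    (h : ℝ≥0) :
    μ {ω | ∃ n, gridWalk D M h n ω ≤ 0} ≤
      .ofReal (Real.exp (-interruptionExponent R * D)) := by
  refine measure_exists_nonpos_le (measurable_gridWalk hM D h) hD (gridWalk_zero hM D h)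
    (indepFun_gridWalk hM D h) (interruptionExponent_pos hR).le fun n => ?_
  rw [laplace_gridWalk hM, cramerExponent_interruptionExponent (by linarith)]
  simp

theorem le_measure_exists_gridWalk_nonpos (hR : 1 < R) (hM : HasPoissonGrid μ R M) (hD : 0 ≤ D)
    {h : ℝ≥0} (hh : 0 < h) :
    .ofReal (Real.exp (-interruptionExponent R * D)) ≤
      .ofReal (Real.exp (interruptionExponent R * h)) *
        μ {ω | ∃ n, gridWalk D M h n ω ≤ 0} := by
  have hpos := interruptionExponent_pos hR
  have hneg := cramerExponent_half_neg hR
  refine le_measure_exists_nonpos (measurable_gridWalk hM D h) hD h.2 (gridWalk_zero hM D h)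
    (fun n ω => ?_) (indepFun_gridWalk hM D h) (half_pos hpos).le (half_le_self hpos.le) ?_
    (fun n => ?_) (fun n => laplace_gridWalk hM D h n (interruptionExponent R / 2))
  · have := gridWalk_succ_sub hM D h n ω
    have h0 : (0 : ℝ) ≤ (M ((n + 1 : ℕ) * h) ω - M (n * h) ω : ℕ) := Nat.cast_nonneg _
    change _ - (h : ℝ) ≤ _
    linarith
  · rw [ENNReal.ofReal_lt_one, Real.exp_lt_one_iff]
    exact mul_neg_of_pos_of_neg hh hneg
  · rw [laplace_gridWalk hM, cramerExponent_interruptionExponent (by linarith)]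
    simp

/-- The probability that the buffer empties is at most `e^{-I(R) D}`. -/
theorem measure_exists_buffer_eq_zero_le (hR : 1 < R) (hM : HasPoissonGrid μ R M)
    (hcont : ∀ ω t, ContinuousWithinAt (fun s => M s ω) (Ici t) t) (hD : 0 ≤ D) :
    μ {ω | ∃ t : ℝ≥0, D + M t ω - t = 0} ≤
      .ofReal (Real.exp (-interruptionExponent R * D)) := by
  have hsub : {ω | ∃ t : ℝ≥0, D + M t ω - t = 0} ⊆
      ⋃ m : ℕ, {ω | ∃ n, gridWalk D M (2⁻¹ ^ m) n ω ≤ 0} := by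
    intro ω hω
    exact mem_iUnion.2 (exists_dyadic_nonpos (hcont ω) hω)
  -- Dyadic grids are nested, so the uniform bound passes to the increasing union.
  have hmono : Monotone fun m : ℕ => {ω | ∃ n, gridWalk D M (2⁻¹ ^ m) n ω ≤ 0} := by
    refine monotone_nat_of_le_succ fun m ω ⟨n, hn⟩ => ⟨n * 2, ?_⟩
    have e : ((n * 2 : ℕ) : ℝ≥0) * 2⁻¹ ^ (m + 1) = n * 2⁻¹ ^ m := by
      push_cast
      rw [pow_succ]
      field_simp
    rw [gridWalk, e]
    exact hn
  refine (measure_mono hsub).trans ?_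
  rw [hmono.measure_iUnion]
  exact iSup_le fun m => measure_exists_gridWalk_nonpos_le hR hM hD _

/-- The probability that the buffer empties is at least `e^{-I(R) D}`. -/
theorem le_measure_exists_buffer_nonpos (hR : 1 < R) (hM : HasPoissonGrid μ R M) (hD : 0 ≤ D) :
    .ofReal (Real.exp (-interruptionExponent R * D)) ≤
      μ {ω | ∃ t : ℝ≥0, D + M t ω - t ≤ 0} := by
  set p := μ {ω | ∃ t : ℝ≥0, D + M t ω - t ≤ 0}
  have h1 : ∀ᶠ h : ℝ in 𝓝[>] 0, .ofReal (Real.exp (-interruptionExponent R * D)) ≤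
      .ofReal (Real.exp (interruptionExponent R * h)) * p := by
    filter_upwards [self_mem_nhdsWithin] with h hh
    refine (le_measure_exists_gridWalk_nonpos hR hM hD (h := ⟨h, le_of_lt hh⟩) hh).trans ?_
    refine mul_le_mul_right (measure_mono ?_) _
    rintro ω ⟨n, hn⟩
    exact ⟨_, hn⟩
  have hlim : Tendsto (fun h : ℝ => ENNReal.ofReal (Real.exp (interruptionExponent R * h)) * p)
      (𝓝[>] 0) (𝓝 (ENNReal.ofReal (Real.exp (interruptionExponent R * 0)) * p)) := by
    refine ENNReal.Tendsto.mul_const (ENNReal.tendsto_ofReal ?_) (.inr (measure_ne_top _ _))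
    exact (Continuous.tendsto (by fun_prop) 0).mono_left nhdsWithin_le_nhds
  simpa using ge_of_tendsto hlim h1

end Ruin

/-! ### Control policies -/

section Policies

variable {Ω : Type*} [MeasurableSpace Ω] {μ : Measure Ω} {R₀ R₁ D ε : ℝ}

/-- A constant policy ignores the history, so the feedback equation has an explicit unique solution.
-/
theorem isClosedLoop_freeServerOnly_iff (D : ℝ) (n c : ℝ≥0 → ℕ) (q : ℝ≥0 → ℝ)
    (u : ℝ≥0 → Fin 2) :
    IsClosedLoop freeServerOnly D n c q u ↔ (q = fun t => D + n t - t) ∧ u = fun _ => 0 := by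
  constructor
  · intro h
    obtain rfl : u = fun _ => 0 := funext fun t => (h t).2
    refine ⟨funext fun t => ?_, rfl⟩
    rw [(h t).1, jumpIntegral_zero_left]
    simp
  · rintro ⟨rfl, rfl⟩ t
    refine ⟨?_, rfl⟩
    rw [jumpIntegral_zero_left]
    simp

theorem freeServerOnly_mem_policies (S : TwoServerSystem μ R₀ R₁) (D : ℝ) :
    freeServerOnly ∈ Policies S D := by
  refine ⟨fun t ω => D + S.free t ω - t, fun _ _ => 0, fun t => ?_, measurable_const,
    .of_forall fun ω q v => isClosedLoop_freeServerOnly_iff D _ _ q v⟩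
  have := S.isPoisson_free.measurable t
  fun_prop

theorem ae_isClosedLoop (S : TwoServerSystem μ R₀ R₁) (D : ℝ) (π : Policies S D) :
    ∀ᵐ ω ∂μ, IsClosedLoop π D (fun t => S.free t ω) (fun t => S.costly t ω)
      (fun t => buffer S D π t ω) (fun t => action S D π t ω) := by
  filter_upwards [π.2.choose_spec.choose_spec.2.2] with ω hω
  exact (hω _ _).2 ⟨rfl, rfl⟩

theorem interruptionTime_lt_top_iff (S : TwoServerSystem μ R₀ R₁) (D : ℝ) (π : Policies S D)
    (ω : Ω) : interruptionTime S D π ω < ∞ ↔ ∃ t : ℝ≥0, buffer S D π t ω = 0 := by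
  rw [interruptionTime, sInf_lt_iff]
  exact ⟨fun ⟨_, ⟨t, ht, _⟩, _⟩ => ⟨t, ht⟩,
    fun ⟨t, ht⟩ => ⟨t, ⟨t, ht, rfl⟩, ENNReal.coe_lt_top⟩⟩

theorem cost_freeServerOnly (S : TwoServerSystem μ R₀ R₁) (h : freeServerOnly ∈ Policies S D)
    (hf : IsFeasible S D ε ⟨freeServerOnly, h⟩) : cost S D ε ⟨freeServerOnly, h⟩ = 0 := by
  rw [cost, if_pos hf, lintegral_eq_zero_of_ae_eq_zero]
  filter_upwards [ae_isClosedLoop S D ⟨freeServerOnly, h⟩] with ω hω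
  have hu := congrFun ((isClosedLoop_freeServerOnly_iff _ _ _ _ _).1 hω).2
  simp [hu]

variable [IsProbabilityMeasure μ]

theorem interruptionProb_freeServerOnly_le (hR₀ : 1 < R₀) (S : TwoServerSystem μ R₀ R₁)
    (hD : 0 ≤ D) (h : freeServerOnly ∈ Policies S D) :
    interruptionProb S D ⟨freeServerOnly, h⟩ ≤ Real.exp (-interruptionExponent R₀ * D) := by
  refine ENNReal.toReal_le_of_le_ofReal (Real.exp_pos _).le (le_trans (measure_mono_ae ?_)
    (measure_exists_buffer_eq_zero_le hR₀ (S.isPoisson_free.hasPoissonGrid (by linarith))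
      S.isPoisson_free.rightCont hD))
  filter_upwards [ae_isClosedLoop S D ⟨freeServerOnly, h⟩] with ω hω hτ
  obtain ⟨t, ht⟩ := (interruptionTime_lt_top_iff S D _ ω).1 hτ
  have hq := congrFun ((isClosedLoop_freeServerOnly_iff _ _ _ _ _).1 hω).1 t
  exact ⟨t, hq.symm.trans ht⟩

/-- No policy interrupts less often than the permanent use of both servers. -/
theorem le_interruptionProb (hR₀ : 1 < R₀) (hR₁ : R₀ < R₁) (S : TwoServerSystem μ R₀ R₁)
    (hD : 0 ≤ D) (π : Policies S D) :
    Real.exp (-interruptionExponent R₁ * D) ≤ interruptionProb S D π := by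
  have hM : HasPoissonGrid μ R₁ fun t ω => S.free t ω + S.costly t ω := by
    simpa using (S.isPoisson_free.hasPoissonGrid (by linarith)).add
      (S.isPoisson_costly.hasPoissonGrid (by linarith)) S.indep
  refine (ENNReal.ofReal_le_iff_le_toReal (measure_ne_top _ _)).1
    ((le_measure_exists_buffer_nonpos (hR₀.trans hR₁) hM hD).trans (measure_mono_ae ?_))
  filter_upwards [ae_isClosedLoop S D π] with ω hω ⟨t, ht⟩
  have hc := S.isPoisson_costly.mono ω
  set u : ℝ≥0 → Fin 2 := fun t => action S D π t ω
  have hq : ∀ t : ℝ≥0, buffer S D π t ω =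
      D + (S.free t ω + jumpIntegral u (fun t => S.costly t ω) t : ℕ) - t := by
    intro t
    refine (hω t).1.trans ?_
    push_cast
    ring
  have hle : (jumpIntegral u (fun t => S.costly t ω) t : ℝ) ≤ S.costly t ω :=
    Nat.cast_le.2 (jumpIntegral_le hc u t)
  refine (interruptionTime_lt_top_iff S D π ω).2 ?_
  simp_rw [hq]
  -- The accepted arrivals form a monotone counting path below the total arrivals, so nonpositivity
  -- passes down to this buffer and forces an exact zero.
  refine exists_eq_zero_of_nonpos
    ((S.isPoisson_free.mono ω).add (jumpIntegral_mono hc u)) hD ⟨t, ?_⟩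
  push_cast at ht ⊢
  linarith

end Policies

end Streaming

theorem mainTheorem10 {Ω : Type*} [MeasurableSpace Ω] (μ : Measure Ω) [IsProbabilityMeasure μ]
    (R₀ R₁ : ℝ) (hR₀ : 1 < R₀) (hR₁ : R₀ < R₁) (S : Streaming.TwoServerSystem μ R₀ R₁)
    (D ε : ℝ) (hD : 0 ≤ D) (hε : 0 < ε) :
    (1 / Streaming.interruptionExponent R₀ * Real.log (1 / ε) ≤ D →
      (∃ h : Streaming.freeServerOnly ∈ Streaming.Policies S D,
        Streaming.IsFeasible S D ε ⟨Streaming.freeServerOnly, h⟩ ∧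
        Streaming.cost S D ε ⟨Streaming.freeServerOnly, h⟩ = 0) ∧
      IsLeast (Set.range (Streaming.cost S D ε)) 0) ∧
    (D < 1 / Streaming.interruptionExponent R₁ * Real.log (1 / ε) →
      (∀ π : Streaming.Policies S D, ¬ Streaming.IsFeasible S D ε π) ∧
      IsLeast (Set.range (Streaming.cost S D ε)) ∞) := by
  have hmem := Streaming.freeServerOnly_mem_policies S D
  have hI₀ := Streaming.interruptionExponent_pos hR₀
  have hI₁ := Streaming.interruptionExponent_pos (hR₀.trans hR₁)
  rw [one_div ε, Real.log_inv, one_div_mul_eq_div, one_div_mul_eq_div, div_le_iff₀ hI₀,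
    lt_div_iff₀ hI₁]
  refine ⟨fun h => ?_, fun h => ?_⟩
  · have hf : Streaming.IsFeasible S D ε ⟨Streaming.freeServerOnly, hmem⟩ := by
      refine (Streaming.interruptionProb_freeServerOnly_le hR₀ S hD hmem).trans ?_
      rw [← Real.le_log_iff_exp_le hε]
      linarith
    have hcost := Streaming.cost_freeServerOnly S hmem hf
    exact ⟨⟨hmem, hf, hcost⟩, ⟨_, hcost⟩, fun _ _ => zero_le⟩
  · have hf : ∀ π : Streaming.Policies S D, ¬ Streaming.IsFeasible S D ε π := by
      refine fun π hπ => ((Streaming.le_interruptionProb hR₀ hR₁ S hD π).trans hπ).not_gt ?_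
      rw [← Real.log_lt_iff_lt_exp hε]
      linarith
    have hcost : ∀ π, Streaming.cost S D ε π = ∞ := fun π => if_neg (hf π)
    -- Attaining `∞` requires some policy to exist; the free-server policy is one.
    refine ⟨hf, ⟨⟨_, hmem⟩, hcost _⟩, ?_⟩
    rintro _ ⟨π, rfl⟩
    exact (hcost π).ge
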